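/- Let $G$ be the Heisenberg group of real matrices $$(a,b,c):=\begin{pmatrix}1&a&c\\0&1&b\\0&0&1\end{pmatrix},\qquad a,b,c\in\mathbb R,$$ and let $H\subset G$ be the subgroup of the matrices with $a,b,c\in\mathbb Z$. In the coordinates $(x,y,z)=(a,b,c-\tfrac{ab}{2})$ consider the left-invariant vector fields $$X_1=\frac{\partial}{\partial x}-\frac y2\frac{\partial}{\partial z},\qquad X_2=\frac{\partial}{\partial y}+\frac x2\frac{\partial}{\partial z}.$$ A horizontal curve is a Lipschitz curve $q:[0,T]\to G$, $T>0$, with $\dot q(t)=u_1(t)X_1(q(t))+u_2(t)X_2(q(t))$ for almost every $t$; its length is $\int_0^T\sqrt{u_1^2+u_2^2}\,dt$. Let $d$ be the sub-Riemannian distance on $G$ (the infimum of the lengths of the horizontal curves joining two points), let $B_t(g)=\{g'\in G\mid d(g,g')\le t\}$, and let $B_t=B_t(\mathrm{Id})$. Put $$\hat t=\sup\{t>0\mid B_t(h_1)\cap B_t(h_2)=\emptyset\ \text{ for all } h_1\ne h_2 \text{ in } H\}.$$ Then $\hat t=\tfrac12$. Moreover, in the coordinates $(a,b,c)$, $$B_{1/2}\cap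 B_{1/2}(\pm1,0,0)=\{(\pm\tfrac12,0,0)\},\qquad B_{1/2}\cap B_{1/2}(0,\pm1,0)=\{(0,\pm\tfrac12,0)\},$$ and $B_{1/2}\cap B_{1/2}(h)=\emptyset$ for every other $h\in H\setminus\{\mathrm{Id}\}$. -/

import Mathlib

open scoped NNReal ENNReal

/-- The Heisenberg group: `⟨a, b, c⟩` stands for the unipotent matrix
`!![1, a, c; 0, 1, b; 0, 0, 1]`. -/
@[ext]
structure Heis where
  a : ℝ
  b : ℝ
  c : ℝ

namespace Heis

/-- The upper unitriangular matrix that an element of the Heisenberg group stands for. -/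
def toMatrix (g : Heis) : Matrix (Fin 3) (Fin 3) ℝ :=
  !![1, g.a, g.c; 0, 1, g.b; 0, 0, 1]

instance : One Heis := ⟨⟨0, 0, 0⟩⟩

instance : Mul Heis := ⟨fun g h => ⟨g.a + h.a, g.b + h.b, g.c + h.c + g.a * h.b⟩⟩

instance : Inv Heis := ⟨fun g => ⟨-g.a, -g.b, -g.c + g.a * g.b⟩⟩

@[simp] theorem one_a : (1 : Heis).a = 0 := rfl
@[simp] theorem one_b : (1 : Heis).b = 0 := rfl
@[simp] theorem one_c : (1 : Heis).c = 0 := rfl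
@[simp] theorem mul_a (g h : Heis) : (g * h).a = g.a + h.a := rfl
@[simp] theorem mul_b (g h : Heis) : (g * h).b = g.b + h.b := rfl
@[simp] theorem mul_c (g h : Heis) : (g * h).c = g.c + h.c + g.a * h.b := rfl
@[simp] theorem inv_a (g : Heis) : g⁻¹.a = -g.a := rfl
@[simp] theorem inv_b (g : Heis) : g⁻¹.b = -g.b := rfl
@[simp] theorem inv_c (g : Heis) : g⁻¹.c = -g.c + g.a * g.b := rfl

instance : Group Heis :=
  Group.ofLeftAxioms
    (fun g h k => by ext <;> simp <;> ring)
    (fun g => by ext <;> simp)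
    (fun g => by ext <;> simp)

/-- The group operation is matrix multiplication. -/
theorem toMatrix_mul (g h : Heis) : (g * h).toMatrix = g.toMatrix * h.toMatrix := by
  ext i j
  fin_cases i <;> fin_cases j <;>
    simp [toMatrix, Matrix.mul_apply, Fin.sum_univ_three] <;> ring

theorem toMatrix_injective : Function.Injective toMatrix := by
  intro g h hgh
  ext
  · simpa [toMatrix] using congrFun (congrFun hgh 0) 1
  · simpa [toMatrix] using congrFun (congrFun hgh 1) 2
  · simpa [toMatrix] using congrFun (congrFun hgh 0) 2

/-- The discrete subgroup of the matrices with integer entries. -/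
def intLattice : Subgroup Heis where
  carrier := {g | ∃ m n k : ℤ, g = ⟨m, n, k⟩}
  one_mem' := ⟨0, 0, 0, by ext <;> simp⟩
  mul_mem' := by
    rintro _ _ ⟨m, n, k, rfl⟩ ⟨m', n', k', rfl⟩
    exact ⟨m + m', n + n', k + k' + m * n', by ext <;> simp⟩
  inv_mem' := by
    rintro _ ⟨m, n, k, rfl⟩
    exact ⟨-m, -n, -k + m * n, by ext <;> simp⟩

/-- The global chart `(x, y, z)` of the group, in which `a = x`, `b = y`, `c = z + x * y / 2`. -/
noncomputable def xyz (g : Heis) : ℝ × ℝ × ℝ := (g.a, g.b, g.c - g.a * g.b / 2)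

/-- The left-invariant field `X₁ = ∂/∂x - (y/2) ∂/∂z`, in the chart `(x, y, z)`. -/
noncomputable def X₁ (g : Heis) : ℝ × ℝ × ℝ := (1, 0, -(g.xyz.2.1 / 2))

/-- The left-invariant field `X₂ = ∂/∂y + (x/2) ∂/∂z`, in the chart `(x, y, z)`. -/
noncomputable def X₂ (g : Heis) : ℝ × ℝ × ℝ := (0, 1, g.xyz.1 / 2)

/-- `q : [0, T] → G` is a horizontal curve: it is Lipschitz in the chart, and at almost every
time `t` its velocity is the combination `u₁(t) X₁ + u₂(t) X₂` of the frame. The control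
`u = (u₁, u₂)` is determined by `q` almost everywhere, as `X₁`, `X₂` are independent. -/
structure IsHorizontal (q : ℝ → Heis) (u : ℝ → ℝ × ℝ) (T : ℝ) : Prop where
  lipschitz : ∃ K : ℝ≥0, LipschitzOnWith K (fun t => (q t).xyz) (Set.Icc 0 T)
  velocity : ∀ᵐ t ∂(MeasureTheory.volume.restrict (Set.Icc 0 T)),
    HasDerivAt (fun s => (q s).xyz) ((u t).1 • X₁ (q t) + (u t).2 • X₂ (q t)) t

/-- The sub-Riemannian length `∫₀ᵀ (u₁² + u₂²)^(1/2) dt` of a horizontal curve on `[0, T]` with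
control `u`, for the inner product that makes `X₁`, `X₂` orthonormal. -/
noncomputable def srLength (u : ℝ → ℝ × ℝ) (T : ℝ) : ℝ≥0∞ :=
  ∫⁻ t in Set.Icc 0 T, ENNReal.ofReal (Real.sqrt ((u t).1 ^ 2 + (u t).2 ^ 2))

/-- The sub-Riemannian distance: the infimum of the lengths of the horizontal curves that join
the two points. -/
noncomputable def srDist (g₀ g₁ : Heis) : ℝ≥0∞ :=
  sInf {ℓ | ∃ (T : ℝ) (q : ℝ → Heis) (u : ℝ → ℝ × ℝ),
    0 < T ∧ IsHorizontal q u T ∧ q 0 = g₀ ∧ q T = g₁ ∧ ℓ = srLength u T}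

/-- The closed sub-Riemannian ball of radius `t` centred at `g`. -/
def srBall (t : ℝ) (g : Heis) : Set Heis := {g' | srDist g g' ≤ ENNReal.ofReal t}

/-- The radii `t > 0` for which the balls centred at the points of the integer subgroup are
pairwise disjoint. -/
def packingRadii : Set ℝ :=
  {t | 0 < t ∧ ∀ h₁ ∈ intLattice, ∀ h₂ ∈ intLattice, h₁ ≠ h₂ →
    srBall t h₁ ∩ srBall t h₂ = ∅}

/-- The supremal radius for which the balls are pairwise disjoint. -/
noncomputable def tHat : ℝ := sSup packingRadii

end Heis

namespace Heis

open MeasureTheory Set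

/-! A horizontal curve has the same length as its projection to the `(a, b)` plane, so balls of
radius 1/2 project into discs of radius 1/2. By left invariance one centre may be the identity; if
the other is `(m, n, k)`, a common point forces `m ^ 2 + n ^ 2 ≤ 1`.

If `m = n = 0`, the crude isoperimetric bound `IsHorizontal.abs_vertical_le` keeps both heights too
small to differ by a nonzero integer. If `m ^ 2 + n ^ 2 = 1`, the common point lies over the
midpoint of the planar segment, at the full radius from both ends. Then `IsHorizontal.calibration`
shows that no height can be gained from either centre (`vertical_eq_zero_of_srDist_one_le`), whence
`c = k = 0`. Conversely, straight segments reach these midpoints. -/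

/-- If the derivative of an absolutely continuous function is almost everywhere at most `C` times
a speed `s`, then its increment is at most `C` times a bound on the length. -/
theorem sub_le_mul_of_deriv_le_speed {f f' s : ℝ → ℝ} {T τ C ℓ : ℝ}
    (hf : AbsolutelyContinuousOnInterval f 0 T)
    (hd : ∀ᵐ t ∂(volume.restrict (Icc 0 T)), HasDerivAt f (f' t) t ∧ f' t ≤ C * s t)
    (hC : 0 ≤ C) (hℓ : 0 ≤ ℓ)
    (hs : ∫⁻ t in Icc 0 T, ENNReal.ofReal (s t) ≤ ENNReal.ofReal ℓ) (hτ : τ ∈ Icc 0 T) :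
    f τ - f 0 ≤ C * ℓ := by
  have hsub : Icc 0 τ ⊆ Icc 0 T := Icc_subset_Icc_right hτ.2
  have hf' : AbsolutelyContinuousOnInterval f 0 τ := hf.mono (by
    rw [uIcc_of_le hτ.1, uIcc_of_le (hτ.1.trans hτ.2)]; exact hsub)
  have hint : Integrable (deriv f) (volume.restrict (Icc 0 τ)) :=
    (intervalIntegrable_iff_integrableOn_Icc_of_le hτ.1).1 hf'.intervalIntegrable_deriv
  rw [← hf'.integral_deriv_eq_sub, intervalIntegral.integral_of_le hτ.1,
    ← integral_Icc_eq_integral_Ioc]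
  -- Dropping the negative part leaves a lower integral, which is compared with that of `s` without
  -- any measurability of `s`.
  rw [integral_eq_lintegral_pos_part_sub_lintegral_neg_part hint]
  refine (sub_le_self _ ENNReal.toReal_nonneg).trans ?_
  refine ENNReal.toReal_le_of_le_ofReal (mul_nonneg hC hℓ) ?_
  calc ∫⁻ t in Icc 0 τ, ENNReal.ofReal (deriv f t)
      ≤ ∫⁻ t in Icc 0 τ, ENNReal.ofReal C * ENNReal.ofReal (s t) := by
        refine lintegral_mono_ae ?_
        filter_upwards [ae_restrict_of_ae_restrict_of_subset hsub hd] with t ht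
        rw [ht.1.deriv, ← ENNReal.ofReal_mul hC]
        exact ENNReal.ofReal_le_ofReal ht.2
    _ = ENNReal.ofReal C * ∫⁻ t in Icc 0 τ, ENNReal.ofReal (s t) :=
        lintegral_const_mul' _ _ ENNReal.ofReal_ne_top
    _ ≤ ENNReal.ofReal C * ENNReal.ofReal ℓ := by
        gcongr
        exact (lintegral_mono_set hsub).trans hs
    _ = ENNReal.ofReal (C * ℓ) := (ENNReal.ofReal_mul hC).symm

/-! ### Estimates along horizontal curves -/

section Curves

variable {q : ℝ → Heis} {u : ℝ → ℝ × ℝ} {T ℓ : ℝ}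

theorem IsHorizontal.absolutelyContinuous (hq : IsHorizontal q u T) (hT : 0 ≤ T) :
    AbsolutelyContinuousOnInterval (fun t => (q t).xyz.1) 0 T ∧
    AbsolutelyContinuousOnInterval (fun t => (q t).xyz.2.1) 0 T ∧
    AbsolutelyContinuousOnInterval (fun t => (q t).xyz.2.2) 0 T := by
  obtain ⟨K, hK⟩ := hq.lipschitz
  rw [← uIcc_of_le hT] at hK
  have h2 := LipschitzWith.prod_snd.comp_lipschitzOnWith hK
  exact ⟨(LipschitzWith.prod_fst.comp_lipschitzOnWith hK).absolutelyContinuousOnInterval,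
    (LipschitzWith.prod_fst.comp_lipschitzOnWith h2).absolutelyContinuousOnInterval,
    (LipschitzWith.prod_snd.comp_lipschitzOnWith h2).absolutelyContinuousOnInterval⟩

theorem IsHorizontal.ae_hasDerivAt (hq : IsHorizontal q u T) :
    ∀ᵐ t ∂(volume.restrict (Icc 0 T)),
      HasDerivAt (fun s => (q s).xyz.1) (u t).1 t ∧
      HasDerivAt (fun s => (q s).xyz.2.1) (u t).2 t ∧
      HasDerivAt (fun s => (q s).xyz.2.2)
        (((q t).xyz.1 * (u t).2 - (q t).xyz.2.1 * (u t).1) / 2) t := by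
  filter_upwards [hq.velocity] with t ht
  have h1 := (hasFDerivAt_fst (𝕜 := ℝ) (p := (q t).xyz)).comp_hasDerivAt t ht
  have h2 := (hasFDerivAt_snd (𝕜 := ℝ) (p := (q t).xyz)).comp_hasDerivAt t ht
  have h3 := (hasFDerivAt_fst (𝕜 := ℝ) (p := (q t).xyz.2)).comp_hasDerivAt t h2
  have h4 := (hasFDerivAt_snd (𝕜 := ℝ) (p := (q t).xyz.2)).comp_hasDerivAt t h2
  refine ⟨?_, ?_, ?_⟩
  · simpa [X₁, X₂] using! h1
  · simpa [X₁, X₂] using! h3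
  · convert! h4 using 1
    simp [X₁, X₂]
    ring

/-- A horizontal curve of length at most `ℓ` from the identity projects to a planar curve that
stays within distance `ℓ` of the origin. -/
theorem IsHorizontal.sq_add_sq_le (hq : IsHorizontal q u T) (h0 : q 0 = 1) (hℓ : 0 ≤ ℓ)
    (hL : srLength u T ≤ ENNReal.ofReal ℓ) {τ : ℝ} (hτ : τ ∈ Icc 0 T) :
    (q τ).xyz.1 ^ 2 + (q τ).xyz.2.1 ^ 2 ≤ ℓ ^ 2 := by
  obtain ⟨hx, hy, -⟩ := hq.absolutelyContinuous (hτ.1.trans hτ.2)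
  set X := (q τ).xyz.1
  set Y := (q τ).xyz.2.1
  -- The test function is the inner product with the endpoint `(X, Y)`; Cauchy–Schwarz bounds its
  -- rate.
  have key := sub_le_mul_of_deriv_le_speed (C := √(X ^ 2 + Y ^ 2)) (τ := τ)
    (f' := fun t => X * (u t).1 + Y * (u t).2)
    ((hx.const_mul X).fun_add (hy.const_mul Y)) (by
      filter_upwards [hq.ae_hasDerivAt] with t ht
      refine ⟨(ht.1.const_mul X).fun_add (ht.2.1.const_mul Y), ?_⟩
      rw [← Real.sqrt_mul (by positivity)]
      exact Real.le_sqrt_of_sq_le (by nlinarith [sq_nonneg (X * (u t).2 - Y * (u t).1)]))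
    (Real.sqrt_nonneg _) hℓ hL hτ
  have hz : (q 0).xyz = (0, 0, 0) := by simp [h0, xyz]
  simp only [hz, mul_zero, add_zero, sub_zero] at key
  have hR := Real.sq_sqrt (show 0 ≤ X ^ 2 + Y ^ 2 by positivity)
  have hR0 := Real.sqrt_nonneg (X ^ 2 + Y ^ 2)
  have key' : √(X ^ 2 + Y ^ 2) * √(X ^ 2 + Y ^ 2) ≤ √(X ^ 2 + Y ^ 2) * ℓ := by
    change X * X + Y * Y ≤ _ at key
    nlinarith
  rcases hR0.eq_or_lt with h | h
  · rw [← hR, ← h]; nlinarith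
  · rw [← hR]
    exact pow_le_pow_left₀ hR0 (le_of_mul_le_mul_left key' h) 2

/-- A weak isoperimetric inequality for the vertical coordinate. -/
theorem IsHorizontal.abs_vertical_le (hq : IsHorizontal q u T) (hT : 0 ≤ T) (h0 : q 0 = 1)
    (hℓ : 0 ≤ ℓ) (hL : srLength u T ≤ ENNReal.ofReal ℓ) :
    |(q T).xyz.2.2| ≤ ℓ ^ 2 / 2 := by
  obtain ⟨-, -, hz⟩ := hq.absolutelyContinuous hT
  have hz0 : (q 0).xyz = (0, 0, 0) := by simp [h0, xyz]
  have key : ∀ σ : ℝ, σ ^ 2 = 1 → σ * (q T).xyz.2.2 ≤ ℓ ^ 2 / 2 := by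
    intro σ hσ
    -- The height changes at half the cross product of position and velocity, and the position stays
    -- in the disc of radius `ℓ`.
    have := sub_le_mul_of_deriv_le_speed (C := ℓ / 2) (hz.const_mul σ) (by
      filter_upwards [hq.ae_hasDerivAt, ae_restrict_mem measurableSet_Icc] with t ht hm
      refine ⟨ht.2.2.const_mul σ, ?_⟩
      have hp := hq.sq_add_sq_le h0 hℓ hL hm
      set x := (q t).xyz.1
      set y := (q t).xyz.2.1
      have : σ * (x * (u t).2 - y * (u t).1) ≤ ℓ * √((u t).1 ^ 2 + (u t).2 ^ 2) := by
        rw [← Real.sqrt_sq hℓ, ← Real.sqrt_mul (by positivity)]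
        apply Real.le_sqrt_of_sq_le
        rw [mul_pow, hσ]
        nlinarith [sq_nonneg (x * (u t).1 + y * (u t).2),
          mul_le_mul_of_nonneg_right hp (show 0 ≤ (u t).1 ^ 2 + (u t).2 ^ 2 by positivity)]
      linarith) (by positivity) hℓ hL (right_mem_Icc.2 hT)
    simp only [hz0, mul_zero, sub_zero] at this
    linarith
  exact abs_le.2 ⟨by linarith [key (-1) (by norm_num)], by linarith [key 1 (by norm_num)]⟩

/-- A calibration inequality: in the direction of a unit vector `e`, a horizontal curve cannot
both travel almost its full length and gain height. -/
theorem IsHorizontal.calibration (hq : IsHorizontal q u T) (hT : 0 ≤ T) (h0 : q 0 = 1)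
    (hℓ : 0 ≤ ℓ) (hL : srLength u T ≤ ENNReal.ofReal ℓ) {e₁ e₂ s σ : ℝ}
    (he : e₁ ^ 2 + e₂ ^ 2 = 1) (hσ : σ ^ 2 = 1) :
    (1 - s ^ 2) * ℓ * (e₁ * (q T).xyz.1 + e₂ * (q T).xyz.2.1) + 2 * s * σ * ((q T).xyz.2.2 +
      (e₁ * (q T).xyz.1 + e₂ * (q T).xyz.2.1) * (e₁ * (q T).xyz.2.1 - e₂ * (q T).xyz.1) / 2)
      ≤ (1 + s ^ 2) * ℓ ^ 2 := by
  obtain ⟨hx, hy, hz⟩ := hq.absolutelyContinuous hT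
  have hz0 : (q 0).xyz = (0, 0, 0) := by simp [h0, xyz]
  have hα := (hx.const_mul e₁).fun_add (hy.const_mul e₂)
  have hβ := (hy.const_mul e₁).fun_sub (hx.const_mul e₂)
  -- With `α`, `β` the planar coordinates along and across `e`, adding `α * β / 2` to the height
  -- turns its rate into `α * β'`, where `|α| ≤ ℓ`.
  have key := sub_le_mul_of_deriv_le_speed (C := (1 + s ^ 2) * ℓ) (s := fun t =>
      √((u t).1 ^ 2 + (u t).2 ^ 2)) (f' := fun t =>
      (1 - s ^ 2) * ℓ * (e₁ * (u t).1 + e₂ * (u t).2) + 2 * s * σ *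
        ((e₁ * (q t).xyz.1 + e₂ * (q t).xyz.2.1) * (e₁ * (u t).2 - e₂ * (u t).1)))
    ((hα.const_mul ((1 - s ^ 2) * ℓ)).fun_add
      ((hz.fun_add ((hα.fun_mul hβ).const_mul (1 / 2))).const_mul (2 * s * σ))) (by
      filter_upwards [hq.ae_hasDerivAt, ae_restrict_mem measurableSet_Icc] with t ht hm
      have hp := hq.sq_add_sq_le h0 hℓ hL hm
      have dα := (ht.1.const_mul e₁).fun_add (ht.2.1.const_mul e₂)
      have dβ := (ht.2.1.const_mul e₁).fun_sub (ht.1.const_mul e₂)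
      constructor
      · convert! (dα.const_mul ((1 - s ^ 2) * ℓ)).fun_add
          ((ht.2.2.fun_add ((dα.fun_mul dβ).const_mul (1 / 2))).const_mul (2 * s * σ)) using 1
        linear_combination (s * σ * ((q t).xyz.1 * (u t).2 - (q t).xyz.2.1 * (u t).1)) * he
      · set x := (q t).xyz.1
        set y := (q t).xyz.2.1
        set v := (u t).1
        set w := (u t).2
        have hα2 : (e₁ * x + e₂ * y) ^ 2 ≤ ℓ ^ 2 := by
          nlinarith [sq_nonneg (e₁ * y - e₂ * x)]
        have hvw : (e₁ * v + e₂ * w) ^ 2 + (e₁ * w - e₂ * v) ^ 2 = v ^ 2 + w ^ 2 := by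
          linear_combination (v ^ 2 + w ^ 2) * he
        set A := e₁ * x + e₂ * y
        set P := e₁ * v + e₂ * w
        set Q := e₁ * w - e₂ * v
        have h1 : σ * s * (A * Q) ≤ ℓ * |s * Q| := by
          have : |σ * A| ≤ ℓ := abs_le_of_sq_le_sq (by rw [mul_pow, hσ, one_mul]; exact hα2) hℓ
          calc σ * s * (A * Q) = (σ * A) * (s * Q) := by ring
            _ ≤ |σ * A| * |s * Q| := by rw [← abs_mul]; exact le_abs_self _
            _ ≤ ℓ * |s * Q| := by gcongr
        -- Cauchy–Schwarz, as the vector `(1 - s ^ 2, 2 * |s|)` has norm `1 + s ^ 2`.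
        have h2 : (1 - s ^ 2) * P + 2 * |s * Q| ≤ (1 + s ^ 2) * √(v ^ 2 + w ^ 2) := by
          rw [← Real.sqrt_sq (show 0 ≤ 1 + s ^ 2 by positivity),
            ← Real.sqrt_mul (by positivity)]
          apply Real.le_sqrt_of_sq_le
          rw [← hvw, abs_mul]
          have e1 := sq_abs s
          have e2 := sq_abs Q
          rw [← e1, ← e2]
          nlinarith [sq_nonneg ((1 - |s| ^ 2) * |Q| - 2 * |s| * P)]
        nlinarith [mul_le_mul_of_nonneg_left h2 hℓ]) (by positivity) hℓ hL (right_mem_Icc.2 hT)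
  simp only [hz0, mul_zero, sub_zero, add_zero] at key
  linarith

end Curves

/-! ### From curves to the distance -/

/-- The slack `t < ℓ` avoids proving that minimizers exist. -/
theorem exists_isHorizontal_of_srDist_lt {g₀ g₁ : Heis} {t ℓ : ℝ}
    (h : srDist g₀ g₁ ≤ ENNReal.ofReal t) (ht : t < ℓ) (hℓ : 0 < ℓ) :
    ∃ (T : ℝ) (q : ℝ → Heis) (u : ℝ → ℝ × ℝ), 0 < T ∧ IsHorizontal q u T ∧ q 0 = g₀ ∧ q T = g₁ ∧
      srLength u T ≤ ENNReal.ofReal ℓ := by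
  have h' := h.trans_lt ((ENNReal.ofReal_lt_ofReal_iff hℓ).2 ht)
  obtain ⟨_, ⟨T, q, u, hT, hq, h0, h1, rfl⟩, hlt⟩ := sInf_lt_iff.1 h'
  exact ⟨T, q, u, hT, hq, h0, h1, hlt.le⟩

theorem sq_add_sq_le_of_srDist_one_le {g : Heis} {t : ℝ} (ht : 0 ≤ t)
    (h : srDist 1 g ≤ ENNReal.ofReal t) : g.a ^ 2 + g.b ^ 2 ≤ t ^ 2 := by
  have key : √(g.a ^ 2 + g.b ^ 2) ≤ t := by
    refine le_of_forall_gt_imp_ge_of_dense fun ℓ hℓ => ?_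
    have hℓ0 := ht.trans_lt hℓ
    obtain ⟨T, q, u, hT, hq, h0, rfl, hL⟩ := exists_isHorizontal_of_srDist_lt h hℓ hℓ0
    exact Real.sqrt_le_iff.2 ⟨hℓ0.le, hq.sq_add_sq_le h0 hℓ0.le hL (right_mem_Icc.2 hT.le)⟩
  exact (Real.sqrt_le_iff.1 key).2

theorem abs_vertical_le_of_srDist_one_le {g : Heis} {t ℓ : ℝ} (ht : 0 ≤ t) (hℓ : t < ℓ)
    (h : srDist 1 g ≤ ENNReal.ofReal t) : |g.c - g.a * g.b / 2| ≤ ℓ ^ 2 / 2 := by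
  have hℓ0 := ht.trans_lt hℓ
  obtain ⟨T, q, u, hT, hq, h0, rfl, hL⟩ := exists_isHorizontal_of_srDist_lt h hℓ hℓ0
  exact hq.abs_vertical_le hT.le h0 hℓ0.le hL

/-- A point whose distance from the identity equals the distance of the projections has vanishing
vertical coordinate. -/
theorem vertical_eq_zero_of_srDist_one_le {g : Heis} {t e₁ e₂ : ℝ} (ht : 0 < t)
    (he : e₁ ^ 2 + e₂ ^ 2 = 1) (ha : g.a = t * e₁) (hb : g.b = t * e₂)
    (h : srDist 1 g ≤ ENNReal.ofReal t) : g.c - g.a * g.b / 2 = 0 := by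
  have key : ∀ s : ℝ, 0 < s → s ≤ 1 → |g.c - g.a * g.b / 2| ≤ 4 * t ^ 2 * s := by
    intro s hs hs1
    -- An excess length of order `s ^ 2` costs order `s ^ 2` in the calibration, hence only order
    -- `s` in height after division by `2 * s`.
    have hℓ : t < t * (1 + s ^ 2) := by nlinarith [mul_pos ht (pow_pos hs 2)]
    have hℓ0 := ht.trans hℓ
    obtain ⟨T, q, u, hT, hq, h0, rfl, hL⟩ := exists_isHorizontal_of_srDist_lt h hℓ hℓ0
    have cal : ∀ σ : ℝ, σ ^ 2 = 1 →
        σ * ((q T).c - (q T).a * (q T).b / 2) ≤ 4 * t ^ 2 * s := by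
      intro σ hσ
      have := hq.calibration hT.le h0 hℓ0.le hL (s := s) he hσ
      have e1 : e₁ * (q T).xyz.1 + e₂ * (q T).xyz.2.1 = t := by
        change e₁ * (q T).a + e₂ * (q T).b = t
        rw [ha, hb]; linear_combination t * he
      have e2 : e₁ * (q T).xyz.2.1 - e₂ * (q T).xyz.1 = 0 := by
        change e₁ * (q T).b - e₂ * (q T).a = 0
        rw [ha, hb]; ring
      rw [e1, e2, mul_zero, zero_div, add_zero] at this
      change _ + 2 * s * σ * ((q T).c - (q T).a * (q T).b / 2) ≤ _ at this
      set z := (q T).c - (q T).a * (q T).b / 2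
      have hs2 : s ^ 2 ≤ 1 := pow_le_one₀ hs.le hs1
      have h3 : 2 * s * (σ * z) ≤ 2 * s * (4 * t ^ 2 * s) := by
        have : (1 + s ^ 2) * (3 + s ^ 2) ≤ 8 := by nlinarith [sq_nonneg s]
        nlinarith [mul_le_mul_of_nonneg_left this (show 0 ≤ t ^ 2 * s ^ 2 by positivity)]
      exact le_of_mul_le_mul_left h3 (by positivity)
    exact abs_le.2 ⟨by linarith [cal (-1) (by norm_num)], by linarith [cal 1 (by norm_num)]⟩
  by_contra hne
  have hpos := abs_pos.2 hne
  set z := |g.c - g.a * g.b / 2|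
  have h1 := key 1 one_pos le_rfl
  have h8 : 0 < 8 * t ^ 2 := by positivity
  -- This `s` turns the bound into `z ≤ z / 2`; it is at most 1 by `h1`.
  have := key (z / (8 * t ^ 2)) (by positivity) ((div_le_one h8).2 (by nlinarith))
  have e : 4 * t ^ 2 * (z / (8 * t ^ 2)) = z / 2 := by field_simp; ring
  linarith

/-! ### Left invariance -/

/-- The linear part, in the chart, of left translation by `h`. -/
noncomputable def translationLinear (h : Heis) : (ℝ × ℝ × ℝ) →L[ℝ] ℝ × ℝ × ℝ :=
  let fst := ContinuousLinearMap.fst ℝ ℝ (ℝ × ℝ)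
  let snd := ContinuousLinearMap.snd ℝ ℝ (ℝ × ℝ)
  let y := (ContinuousLinearMap.fst ℝ ℝ ℝ).comp snd
  let z := (ContinuousLinearMap.snd ℝ ℝ ℝ).comp snd
  fst.prod (y.prod (z + (h.a / 2) • y - (h.b / 2) • fst))

theorem translationLinear_apply (h : Heis) (p : ℝ × ℝ × ℝ) :
    translationLinear h p = (p.1, p.2.1, p.2.2 + h.a / 2 * p.2.1 - h.b / 2 * p.1) := by
  simp [translationLinear]

theorem xyz_mul (h g : Heis) : (h * g).xyz = h.xyz + translationLinear h g.xyz := by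
  rw [translationLinear_apply]
  ext <;> simp [xyz]
  ring

/-- Left translation is affine in the chart and its linear part preserves the frame, so the control
is unchanged. -/
theorem IsHorizontal.mul_left {q : ℝ → Heis} {u : ℝ → ℝ × ℝ} {T : ℝ} (hq : IsHorizontal q u T)
    (h : Heis) : IsHorizontal (fun t => h * q t) u T := by
  constructor
  · obtain ⟨K, hK⟩ := hq.lipschitz
    simp only [xyz_mul]
    exact ⟨_, (LipschitzWith.const' (K := 0) h.xyz).lipschitzOnWith.add
      ((translationLinear h).lipschitz.comp_lipschitzOnWith hK)⟩
  · filter_upwards [hq.velocity] with t ht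
    simp only [xyz_mul]
    convert! ((translationLinear h).hasFDerivAt.comp_hasDerivAt t ht).const_add h.xyz using 1
    rw [translationLinear_apply]
    ext <;> simp [X₁, X₂, xyz]
    ring

theorem srDist_mul_left_le (h g g' : Heis) : srDist (h * g) (h * g') ≤ srDist g g' := by
  refine le_sInf ?_
  rintro _ ⟨T, q, u, hT, hq, rfl, rfl, rfl⟩
  exact sInf_le ⟨T, fun t => h * q t, u, hT, hq.mul_left h, rfl, rfl, rfl⟩

theorem srDist_one_inv_mul_le {h g : Heis} {t : ℝ} (hg : g ∈ srBall t h) :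
    srDist 1 (h⁻¹ * g) ≤ ENNReal.ofReal t := by
  have := srDist_mul_left_le h⁻¹ h g
  rw [inv_mul_cancel] at this
  exact this.trans hg

theorem mem_srBall_of_srDist_one {h g : Heis} {t : ℝ}
    (hg : srDist 1 (h⁻¹ * g) ≤ ENNReal.ofReal t) : g ∈ srBall t h := by
  have := srDist_mul_left_le h 1 (h⁻¹ * g)
  rw [mul_one, mul_inv_cancel_left] at this
  exact this.trans hg

/-! ### Contact points of the balls -/

/-- Straight segments are horizontal and bound the distance from above. -/
theorem srDist_one_segment_le (v w : ℝ) :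
    srDist 1 ⟨v, w, v * w / 2⟩ ≤ ENNReal.ofReal √(v ^ 2 + w ^ 2) := by
  have hxyz : ∀ t : ℝ, (⟨t * v, t * w, t * v * (t * w) / 2⟩ : Heis).xyz = t • (v, w, 0) := by
    intro t
    ext <;> simp [xyz]
  refine sInf_le ⟨1, fun t => ⟨t * v, t * w, t * v * (t * w) / 2⟩, fun _ => (v, w), one_pos,
    ⟨?_, ?_⟩, by ext <;> simp, by ext <;> simp, by simp [srLength]⟩
  · simp only [hxyz]
    exact ⟨_, ((ContinuousLinearMap.id ℝ ℝ).smulRight (v, w, (0 : ℝ))).lipschitz.lipschitzOnWith⟩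
  · refine Filter.Eventually.of_forall fun t => ?_
    simp only [hxyz]
    convert! (hasDerivAt_id t).smul_const (v, w, (0 : ℝ)) using 1
    ext <;> simp [X₁, X₂, xyz]
    ring

/-- Straight segments of length 1/2 reach the point from both centres; `m * n = 0` makes the third
matrix entries vanish. -/
theorem midpoint_mem {m n : ℝ} (h1 : m ^ 2 + n ^ 2 = 1) (h0 : m * n = 0) :
    (⟨m / 2, n / 2, 0⟩ : Heis) ∈ srBall (1 / 2) 1 ∩ srBall (1 / 2) ⟨m, n, 0⟩ := by
  have hs : ∀ σ : ℝ, σ ^ 2 = 1 → √((σ * m / 2) ^ 2 + (σ * n / 2) ^ 2) = 1 / 2 := by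
    intro σ hσ
    rw [Real.sqrt_eq_iff_mul_self_eq (by positivity) (by norm_num)]
    linear_combination (m ^ 2 + n ^ 2) / 4 * hσ + h1 / 4
  constructor
  · have := srDist_one_segment_le (1 * m / 2) (1 * n / 2)
    rw [hs 1 (by norm_num)] at this
    change srDist 1 _ ≤ _
    convert! this using 3
    · ring
    · ring
    · linear_combination -h0 / 8
  · apply mem_srBall_of_srDist_one
    have := srDist_one_segment_le (-1 * m / 2) (-1 * n / 2)
    rw [hs (-1) (by norm_num)] at this
    convert! this using 2
    ext
    · simp; ring
    · simp; ring
    · simp; linear_combination 3 / 8 * h0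

/-- Two balls of radius `1 / 2` centred at lattice points, one of them the identity, meet only in
the midpoint of a unit segment. -/
theorem eq_midpoint_of_mem {g h : Heis} (hh : h ∈ intLattice) (hne : h ≠ 1)
    (h1 : g ∈ srBall (1 / 2) 1) (h2 : g ∈ srBall (1 / 2) h) :
    ∃ m n : ℤ, m ^ 2 + n ^ 2 = 1 ∧ h = ⟨m, n, 0⟩ ∧ g = ⟨m / 2, n / 2, 0⟩ := by
  obtain ⟨m, n, k, rfl⟩ := hh
  have h2' := srDist_one_inv_mul_le h2
  have p1 := sq_add_sq_le_of_srDist_one_le (by norm_num) h1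
  have p2 := sq_add_sq_le_of_srDist_one_le (by norm_num) h2'
  simp only [mul_a, mul_b, inv_a, inv_b] at p2
  -- Parallelogram law for the vectors from the two centres to `g`; its equality case gives `hsum`
  -- below.
  have hmn : (m ^ 2 + n ^ 2 : ℝ) ≤ 1 := by
    nlinarith [sq_nonneg (2 * g.a - m), sq_nonneg (2 * g.b - n)]
  have hmn' : m ^ 2 + n ^ 2 ≤ 1 := by exact_mod_cast hmn
  have hnn : 0 ≤ m ^ 2 + n ^ 2 := by positivity
  rcases hnn.eq_or_lt with h0 | h0
  · exfalso
    have hm : m = 0 := by nlinarith [sq_nonneg m, sq_nonneg n]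
    have hn : n = 0 := by nlinarith [sq_nonneg m, sq_nonneg n]
    subst hm hn
    -- Any `ℓ` in `(1/2, 1)` works: the two heights differ by `k`, and `|k| ≤ ℓ ^ 2 < 1`.
    have z1 := abs_vertical_le_of_srDist_one_le (ℓ := 3 / 4) (by norm_num) (by norm_num) h1
    have z2 := abs_vertical_le_of_srDist_one_le (ℓ := 3 / 4) (by norm_num) (by norm_num) h2'
    simp at z2
    rw [abs_le] at z1 z2
    have k1 : (k : ℝ) < 1 := by linarith
    have k2 : (-1 : ℝ) < k := by linarith
    have k1' : k < 1 := by exact_mod_cast k1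
    have k2' : -1 < k := by exact_mod_cast k2
    obtain rfl : k = 0 := by omega
    exact hne (by ext <;> simp)
  · have hu : m ^ 2 + n ^ 2 = 1 := by omega
    have huR : (m ^ 2 + n ^ 2 : ℝ) = 1 := by exact_mod_cast hu
    have hprod : m * n = 0 := by
      by_contra hc
      have := mul_ne_zero_iff.1 hc
      have := sq_pos_of_ne_zero this.1
      have := sq_pos_of_ne_zero (mul_ne_zero_iff.1 hc).2
      omega
    have hprodR : (m * n : ℝ) = 0 := by exact_mod_cast hprod
    have hsum : (2 * g.a - m) ^ 2 + (2 * g.b - n) ^ 2 ≤ 0 := by nlinarith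
    have ha : g.a = 1 / 2 * m := by
      have : 2 * g.a - m = 0 := by nlinarith [sq_nonneg (2 * g.a - m), sq_nonneg (2 * g.b - n)]
      linarith
    have hb : g.b = 1 / 2 * n := by
      have : 2 * g.b - n = 0 := by nlinarith [sq_nonneg (2 * g.a - m), sq_nonneg (2 * g.b - n)]
      linarith
    have c1 := vertical_eq_zero_of_srDist_one_le (by norm_num) huR ha hb h1
    have c2 := vertical_eq_zero_of_srDist_one_le (e₁ := -m) (e₂ := -n) (by norm_num)
      (by linarith) (by simp; linarith) (by simp; linarith) h2'
    simp only [mul_a, mul_b, mul_c, inv_a, inv_b, inv_c] at c2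
    rw [ha, hb] at c1 c2
    have hc : g.c = 0 := by linear_combination c1 + hprodR / 8
    have hk : (k : ℝ) = 0 := by linear_combination -c2 + hc + 3 / 8 * hprodR
    refine ⟨m, n, hu, by rw [hk], ?_⟩
    ext
    · simp [ha]; ring
    · simp [hb]; ring
    · exact hc

theorem srBall_mono {s t : ℝ} (h : s ≤ t) (g : Heis) : srBall s g ⊆ srBall t g :=
  fun _ hg => le_trans hg (ENNReal.ofReal_le_ofReal h)

/-- At radius 1/2 neighbouring balls touch. Below it, a common point would be a contact point of the
larger balls, whose projection is at distance 1/2 from that of the centre. -/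
theorem packingRadii_eq : packingRadii = Ioo 0 (1 / 2) := by
  ext t
  constructor
  · rintro ⟨ht, hd⟩
    refine ⟨ht, lt_of_not_ge fun hle => ?_⟩
    have hmem := midpoint_mem (m := 1) (n := 0) (by norm_num) (by norm_num)
    have := hd 1 (one_mem _) ⟨1, 0, 0⟩ ⟨1, 0, 0, by simp⟩ (by simp [Heis.ext_iff])
    exact (this ▸ ⟨srBall_mono hle _ hmem.1, srBall_mono hle _ hmem.2⟩ :
      (⟨1 / 2, 0 / 2, 0⟩ : Heis) ∈ (∅ : Set Heis))
  · rintro ⟨ht, hlt⟩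
    refine ⟨ht, fun h₁ m₁ h₂ m₂ hne => eq_empty_of_forall_notMem ?_⟩
    rintro g ⟨g1, g2⟩
    have d1 := srDist_one_inv_mul_le g1
    have d2 : h₁⁻¹ * g ∈ srBall t (h₁⁻¹ * h₂) := (srDist_mul_left_le _ _ _).trans g2
    obtain ⟨m, n, hmn, -, hg⟩ := eq_midpoint_of_mem (mul_mem (inv_mem m₁) m₂)
      (fun h => hne (inv_mul_eq_one.1 h)) (srBall_mono hlt.le 1 d1) (srBall_mono hlt.le _ d2)
    have p := sq_add_sq_le_of_srDist_one_le ht.le d1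
    rw [hg] at p
    have hmnR : (m ^ 2 + n ^ 2 : ℝ) = 1 := by exact_mod_cast hmn
    simp only at p
    nlinarith

theorem srBall_inter_srBall_eq {m n : ℤ} (hmn : m ^ 2 + n ^ 2 = 1) (h0 : m * n = 0) :
    srBall (1 / 2) 1 ∩ srBall (1 / 2) ⟨m, n, 0⟩ = {⟨m / 2, n / 2, 0⟩} := by
  have hmnR : (m ^ 2 + n ^ 2 : ℝ) = 1 := by exact_mod_cast hmn
  refine Subset.antisymm ?_ (singleton_subset_iff.2
    (midpoint_mem hmnR (by exact_mod_cast h0)))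
  rintro g ⟨g1, g2⟩
  obtain ⟨m', n', -, he, rfl⟩ := eq_midpoint_of_mem ⟨m, n, 0, by simp⟩ (by
    intro h
    have ha := congrArg Heis.a h
    have hb := congrArg Heis.b h
    simp only [one_a, one_b] at ha hb
    rw [ha, hb] at hmnR
    norm_num at hmnR) g1 g2
  have ha := congrArg Heis.a he
  have hb := congrArg Heis.b he
  simp only at ha hb
  rw [mem_singleton_iff, ha, hb]

end Heis

theorem mainTheorem10 :
    (IsLUB Heis.packingRadii Heis.tHat ∧ Heis.tHat = 1 / 2) ∧
    Heis.srBall (1 / 2) 1 ∩ Heis.srBall (1 / 2) ⟨1, 0, 0⟩ = {⟨1 / 2, 0, 0⟩} ∧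
    Heis.srBall (1 / 2) 1 ∩ Heis.srBall (1 / 2) ⟨-1, 0, 0⟩ = {⟨-(1 / 2), 0, 0⟩} ∧
    Heis.srBall (1 / 2) 1 ∩ Heis.srBall (1 / 2) ⟨0, 1, 0⟩ = {⟨0, 1 / 2, 0⟩} ∧
    Heis.srBall (1 / 2) 1 ∩ Heis.srBall (1 / 2) ⟨0, -1, 0⟩ = {⟨0, -(1 / 2), 0⟩} ∧
    ∀ h ∈ Heis.intLattice, h ≠ 1 → h ≠ ⟨1, 0, 0⟩ → h ≠ ⟨-1, 0, 0⟩ →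
      h ≠ ⟨0, 1, 0⟩ → h ≠ ⟨0, -1, 0⟩ →
      Heis.srBall (1 / 2) 1 ∩ Heis.srBall (1 / 2) h = ∅ := by
  have hlub : IsLUB Heis.packingRadii (1 / 2) := by
    rw [Heis.packingRadii_eq]
    exact isLUB_Ioo (by norm_num)
  have ht : Heis.tHat = 1 / 2 := hlub.csSup_eq (by
    rw [Heis.packingRadii_eq]
    exact Set.nonempty_Ioo.2 (by norm_num))
  refine ⟨⟨ht ▸ hlub, ht⟩, ?_, ?_, ?_, ?_, ?_⟩
  · simpa using Heis.srBall_inter_srBall_eq (m := 1) (n := 0) (by norm_num) (by norm_num)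
  · simpa [neg_div] using Heis.srBall_inter_srBall_eq (m := -1) (n := 0) (by norm_num) (by norm_num)
  · simpa using Heis.srBall_inter_srBall_eq (m := 0) (n := 1) (by norm_num) (by norm_num)
  · simpa [neg_div] using Heis.srBall_inter_srBall_eq (m := 0) (n := -1) (by norm_num) (by norm_num)
  · intro h hh h1 e1 e2 e3 e4
    refine Set.eq_empty_of_forall_notMem ?_
    rintro g ⟨g1, g2⟩
    obtain ⟨m, n, hmn, rfl, -⟩ := Heis.eq_midpoint_of_mem hh h1 g1 g2
    have hm : -1 ≤ m ∧ m ≤ 1 := ⟨by nlinarith [sq_nonneg n], by nlinarith [sq_nonneg n]⟩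
    have hn : -1 ≤ n ∧ n ≤ 1 := ⟨by nlinarith [sq_nonneg m], by nlinarith [sq_nonneg m]⟩
    obtain ⟨hm1, hm2⟩ := hm
    obtain ⟨hn1, hn2⟩ := hn
    interval_cases m <;> interval_cases n <;> simp_all
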